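/- For $m\geq 1$ let $\Pi_m$ be the lattice of set partitions of $\{1,\dots,m\}$ ordered by coarsening. Let $\mathcal G_{\min}\subset\Pi_m\setminus\{\hat 0\}$ be its minimal building set, i.e. the set of elements $G\neq\hat 0$ such that the interval $[\hat 0,G]$ is not a product of proper subposets (equivalently, the partitions with exactly one nonsingleton block). A subset $S\subseteq\mathcal G_{\min}$ is nested if for every antichain $A\subseteq S$ with $|A|\geq 2$ the join $\bigvee A$ does not belong to $\mathcal G_{\min}$. The nested set complex $\mathcal N(\Pi_m,\mathcal G_{\min})$ is the simplicial complex whose vertices are the nonmaximal elements of $\mathcal G_{\min}$ and whose faces are the nested sets of such elements (including $\varnothing$). For a finite simplicial complex $\Delta$ of dimension $d-1$ with $f_i$ faces of cardinality $i$, the $h$-vector $(h_0,\dots,h_d)$ is defined by $\sum_{i=0}^d f_i(y-1)^{d-i}=\sum_{i=0}^d h_i y^{d-i}$ and the $h$-polynomial is $h(\Delta;y)=\sum_{i=0}^d h_i y^i$. A Stirling permutation of the multiset $\{1,1,2,2,\dots,n,n\}$ is a permutation $\pi=\pi_1\cdots\pi_{2n}$ of this multiset such that, for every $i\in\{1,\dots,n\}$,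 all numbers between the two occurrences of $i$ are larger than $i$; let $Q_n$ be the set of these, and let $\mathrm{des}(\pi)$ be the number of indices $1\leq i\leq 2n-1$ with $\pi_i>\pi_{i+1}$. The $n$-th second Eulerian polynomial is $P_n(x)=\sum_{\pi\in Q_n}x^{\mathrm{des}(\pi)}$. **Theorem.** For every integer $n\geq 1$, the $h$-polynomial of $\mathcal N(\Pi_{n+1},\mathcal G_{\min})$ equals the $n$-th second Eulerian polynomial: \[ h(\mathcal N(\Pi_{n+1},\mathcal G_{\min});x)=\sum_{\pi\in Q_n}x^{\mathrm{des}(\pi)}. \] -/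

import Mathlib

open Polynomial

/-! ### Simplicial complexes and their face enumeration -/

/-- A simplicial complex on the vertex set `V`: a collection of finite subsets of `V`, closed under
inclusion and containing every singleton. Unlike in `AbstractSimplicialComplex`, the empty set is
a face, as needed for the face number `f₀ = 1`. -/
structure FaceComplex (V : Type*) where
  /-- the faces, including the empty one -/
  faces : Set (Finset V)
  empty_mem : ∅ ∈ faces
  singleton_mem : ∀ v : V, {v} ∈ faces
  down_closed : ∀ {F F' : Finset V}, F ∈ faces → F' ⊆ F → F' ∈ faces

namespace FaceComplex

variable {V : Type*} (Δ : FaceComplex V)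

/-- `fNum Δ i` is the number of faces of cardinality `i` (for a finite vertex set `V`). -/
noncomputable def fNum (i : ℕ) : ℕ := {F ∈ Δ.faces | F.card = i}.ncard

/-- `topCard Δ = dim Δ + 1`, the largest cardinality of a face (for a finite vertex set `V`). -/
noncomputable def topCard : ℕ := sSup (Finset.card '' Δ.faces)

/-- The polynomial `∑_{i=0}^d f_i (y - 1)^{d-i}`, where `d = dim Δ + 1`. -/
noncomputable def shiftedFPolynomial : ℤ[X] :=
  ∑ i ∈ Finset.range (Δ.topCard + 1), C (Δ.fNum i : ℤ) * (X - 1) ^ (Δ.topCard - i)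

/-- The entries `h_0, …, h_d` of the `h`-vector, determined by
`∑_{i=0}^d f_i (y - 1)^{d-i} = ∑_{i=0}^d h_i y^{d-i}`; used for `i ≤ d` only. -/
noncomputable def hNum (i : ℕ) : ℤ := Δ.shiftedFPolynomial.coeff (Δ.topCard - i)

/-- The `h`-polynomial `∑_{i=0}^d h_i y^i`. -/
noncomputable def hPolynomial : ℤ[X] :=
  ∑ i ∈ Finset.range (Δ.topCard + 1), C (Δ.hNum i) * X ^ i

end FaceComplex

/-! ### Nested set complexes -/

/-- The set of irreducible elements of `L`: the `G ≠ ⊥` such that the interval `[⊥, G]` is not a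
product of proper subposets. -/
def minimalBuildingSet (L : Type*) [Lattice L] [OrderBot L] : Set L :=
  {G | G ≠ ⊥ ∧ ¬ ∃ A B : Set L, A ⊂ Set.Iic G ∧ B ⊂ Set.Iic G ∧
    Nonempty (Set.Iic G ≃o (A × B))}

/-- A finite set `S` of elements of `𝒢` is nested if no antichain in `S` with at least two elements
has its join in `𝒢`. -/
def IsNestedSet {L : Type*} [Lattice L] [OrderBot L] (𝒢 : Set L) (S : Finset L) : Prop :=
  (∀ G ∈ S, G ∈ 𝒢) ∧
    ∀ A ⊆ S, 2 ≤ A.card → IsAntichain (· ≤ ·) (A : Set L) → A.sup id ∉ 𝒢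

/-- The nested set complex `N(L, 𝒢)`: its vertices are the nonmaximal elements of `𝒢`, and its
faces are the nested sets consisting of such elements. -/
def nestedSetComplex (L : Type*) [Lattice L] [OrderBot L] (𝒢 : Set L) :
    FaceComplex {G : L // G ∈ 𝒢 ∧ ¬ Maximal (· ∈ 𝒢) G} where
  faces := {F | IsNestedSet 𝒢 (F.map (Function.Embedding.subtype _))}
  empty_mem := by
    refine ⟨by simp, fun A hA h2 => ?_⟩
    have := Finset.card_le_card hA
    rw [Finset.card_map, Finset.card_empty] at this
    omega
  singleton_mem v := by
    refine ⟨by simpa using v.2.1, fun A hA h2 => ?_⟩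
    have := Finset.card_le_card hA
    rw [Finset.card_map, Finset.card_singleton] at this
    omega
  down_closed {F F'} hF h :=
    ⟨fun G hG => hF.1 G (Finset.map_subset_map.2 h hG),
      fun A hA => hF.2 A (hA.trans (Finset.map_subset_map.2 h))⟩

/-- The lattice `Π_m` of partitions of a set with `m` elements, encoded as equivalence relations
and ordered by coarsening: `r ≤ s` if every block of `r` is contained in a block of `s`. -/
abbrev PartitionLattice (m : ℕ) : Type := Setoid (Fin m)

/-! ### Stirling permutations -/

/-- The one-line notation `l` has the property that all entries strictly between two occurrences
of the same number are larger than that number. -/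
def IsStirling (l : List ℕ) : Prop :=
  ∀ i j k : Fin l.length, i < j → j < k → l.get i = l.get k → l.get i < l.get j

open Classical in
/-- `Q_n`: the Stirling permutations, in one-line notation, of the multiset `{1,1,2,2,…,n,n}`. -/
noncomputable def stirlingPermutations (n : ℕ) : Finset (List ℕ) :=
  (2 • (Finset.Icc 1 n).val : Multiset ℕ).lists.toFinset.filter IsStirling

/-- The number of descents of a word: of positions whose entry exceeds the next entry. -/
def descentNumber (l : List ℕ) : ℕ :=
  (Finset.univ.filter fun i : Fin l.length =>
    ∃ h : (i : ℕ) + 1 < l.length, l.get ⟨i + 1, h⟩ < l.get i).card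

/-- The `n`-th second Eulerian polynomial `∑_{π ∈ Q_n} x^{des π}`. -/
noncomputable def secondEulerianPolynomial (n : ℕ) : ℤ[X] :=
  ∑ π ∈ stirlingPermutations n, X ^ descentNumber π

/-! Both sides satisfy `P (n+1) = (1 + 2 n x) P n + x (1 - x) (P n)'` and agree at `n = 1`.

On the Stirling side, every element of `Q_{n+1}` arises uniquely by inserting the adjacent pair
`n+1, n+1` into one of the `2n+1` gaps of an element of `Q_n`. A descent gap or the final gap keeps
the number of descents, and every other gap raises it by one (`sum_X_pow_descentNumber`).

On the complex side, an irreducible partition is determined by its one nonsingleton block, and a set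
of such partitions is nested exactly when the blocks are pairwise comparable or disjoint
(`isNestedSet_iff`). Adding the singletons and the whole set turns a face into the family of leaf
sets below the nodes of a rooted tree with `n+1` labelled leaves and no node with exactly one child.
Deleting a leaf gives a two-term recurrence for the number of these trees by internal nodes
(`card_fullLaminar_insert`). Substituted into `h(x) = ∑ f_i x^i (1-x)^(d-i)`, it becomes the same
differential recurrence (`wardPolynomial_succ`). -/

/-! ### Stirling permutations and the recurrence for second Eulerian polynomials. -/

/-- The pattern form passes to subwords, which makes inserting and deleting letters easy to handle.
-/
theorem isStirling_iff_sublist (l : List ℕ) :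
    IsStirling l ↔ ∀ x y, [x, y, x].Sublist l → x < y := by
  constructor
  · intro h x y hs
    rw [List.sublist_iff_exists_fin_orderEmbedding_get_eq] at hs
    obtain ⟨f, hf⟩ := hs
    have h0 := hf ⟨0, by simp⟩
    have h1 := hf ⟨1, by simp⟩
    have h2 := hf ⟨2, by simp⟩
    have := h (f ⟨0, by simp⟩) (f ⟨1, by simp⟩) (f ⟨2, by simp⟩) (f.lt_iff_lt.2 (by simp))
      (f.lt_iff_lt.2 (by simp [Fin.lt_def])) (by rw [← h0, ← h2]; rfl)
    rw [← h0, ← h1] at this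
    simpa using this
  · intro h i j k hij hjk he
    apply h
    rw [List.sublist_iff_exists_fin_orderEmbedding_get_eq]
    refine ⟨OrderEmbedding.ofStrictMono (![i, j, k] : Fin 3 → Fin l.length) ?_, ?_⟩
    · intro a b hab
      fin_cases a <;> fin_cases b <;> simp_all
      exact hij.trans hjk
    · intro a
      fin_cases a
      · rfl
      · rfl
      · exact he

theorem IsStirling.insert_pair {a b : List ℕ} {N : ℕ} (h : IsStirling (a ++ b))
    (hN : ∀ x ∈ a ++ b, x < N) : IsStirling (a ++ N :: N :: b) := by
  rw [isStirling_iff_sublist] at h ⊢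
  intro x y hs
  have hNl : N ∉ a ++ b := fun hm => lt_irrefl _ (hN N hm)
  by_cases hx : x = N
  · subst hx
    exfalso
    rw [List.mem_append, not_or] at hNl
    obtain ⟨w, w', e, hw, hw'⟩ := List.sublist_append_iff.1 hs
    cases w with
    | cons z w =>
      rw [List.cons_append, List.cons.injEq] at e
      exact hNl.1 (hw.subset (e.1 ▸ List.mem_cons_self))
    | nil =>
      rw [List.nil_append] at e
      rw [← e, List.cons_sublist_cons] at hw'
      cases hw' with
      | cons _ h' => exact hNl.2 (h'.subset (by simp))
      | cons_cons _ h' => exact hNl.2 (h'.subset (by simp))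
  · have hxm : x ∈ a ++ b := by
      have := hs.subset (List.mem_cons_self)
      grind
    by_cases hy : y = N
    · exact hy ▸ hN x hxm
    · apply h
      -- Erasing every `N` leaves the pattern intact and turns the long word into `a ++ b`.
      have h1 := hs.filter (fun z => decide (z ≠ N))
      have e1 : [x, y, x].filter (fun z => decide (z ≠ N)) = [x, y, x] := by simp [hx, hy]
      have e2 : (a ++ N :: N :: b).filter (fun z => decide (z ≠ N)) = a ++ b := by
        have e3 : (a ++ b).filter (fun z => decide (z ≠ N)) = a ++ b := by
          rw [List.filter_eq_self]; intro z hz; simpa using (hN z hz).ne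
        rw [← e3]; simp
      rwa [e1, e2] at h1

/-- A letter between the two copies of the maximum `N` would have to exceed `N`, so the copies are
adjacent. -/
theorem IsStirling.exists_insert_pair {l : List ℕ} {N : ℕ} (h : IsStirling l)
    (hN : ∀ x ∈ l, x ≤ N) (hc : l.count N = 2) :
    ∃ a b, l = a ++ N :: N :: b ∧ N ∉ a ∧ N ∉ b := by
  rw [isStirling_iff_sublist] at h
  have hm : N ∈ l := List.count_pos_iff.1 (by omega)
  obtain ⟨a, r, rfl, ha⟩ := List.eq_append_cons_of_mem hm
  rw [List.count_append, List.count_cons_self, List.count_eq_zero.2 ha] at hc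
  have hr : N ∈ r := List.count_pos_iff.1 (by omega)
  obtain ⟨c, b, rfl, hc'⟩ := List.eq_append_cons_of_mem hr
  rw [List.count_append, List.count_cons_self, List.count_eq_zero.2 hc'] at hc
  have hb : N ∉ b := List.count_eq_zero.1 (by omega)
  cases c with
  | nil => exact ⟨a, b, rfl, ha, hb⟩
  | cons y c =>
    have h1 := h N y (by
      refine List.Sublist.trans ?_ (List.sublist_append_right _ _)
      simp)
    have h2 := hN y (by simp)
    omega

theorem descentNumber_nil : descentNumber [] = 0 := by simp [descentNumber]

theorem descentNumber_singleton (x : ℕ) : descentNumber [x] = 0 := by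
  rw [descentNumber, Finset.card_eq_zero, Finset.filter_eq_empty_iff]
  rintro i - ⟨h, -⟩
  simp at h

theorem descentNumber_cons_cons (x y : ℕ) (l : List ℕ) :
    descentNumber (x :: y :: l) = (if y < x then 1 else 0) + descentNumber (y :: l) := by
  simp only [descentNumber, Finset.card_filter]
  erw [Fin.sum_univ_succ]
  simp

/-- The gap before `x` is left out so that the induction can peel off the head: `x` stays first, and
its comparison with the next letter changes only when the pair is inserted directly after it. -/
theorem sum_X_pow_descentNumber_cons (N : ℕ) (x : ℕ) (l : List ℕ) (hN : ∀ y ∈ x :: l, y < N) :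
    ∑ p ∈ Finset.range (l.length + 1),
      (X : ℤ[X]) ^ descentNumber (x :: (l.take p ++ N :: N :: l.drop p)) =
    ((descentNumber (x :: l) : ℤ[X]) + 1) * X ^ descentNumber (x :: l) +
      ((l.length : ℤ[X]) - (descentNumber (x :: l) : ℤ[X])) * X ^ (descentNumber (x :: l) + 1) := by
  induction l generalizing x with
  | nil =>
    have : ¬ N < x := by have := hN x (by simp); omega
    simp [descentNumber_cons_cons, descentNumber_singleton, this]
  | cons y l ih =>
    have h1 : ¬ N < x := by have := hN x (by simp); omega
    have h2 : y < N := hN y (by simp)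
    have ih := ih y (fun z hz => hN z (List.mem_cons_of_mem _ hz))
    rw [List.length_cons, Finset.sum_range_succ']
    simp only [List.take_succ_cons, List.drop_succ_cons, List.cons_append, descentNumber_cons_cons x y,
      pow_add, ← Finset.mul_sum, ih, List.take_zero, List.drop_zero, List.nil_append,
      descentNumber_cons_cons, h1, h2, if_false, if_true, lt_irrefl]
    split_ifs <;> push_cast <;> ring

theorem sum_X_pow_descentNumber (N : ℕ) (l : List ℕ) (hN : ∀ y ∈ l, y < N) :
    ∑ p ∈ Finset.range (l.length + 1),
      (X : ℤ[X]) ^ descentNumber (l.take p ++ N :: N :: l.drop p) =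
    ((descentNumber l : ℤ[X]) + 1) * X ^ descentNumber l +
      ((l.length : ℤ[X]) - (descentNumber l : ℤ[X])) * X ^ (descentNumber l + 1) := by
  cases l with
  | nil => simp [descentNumber_cons_cons, descentNumber_singleton, descentNumber_nil]
  | cons x l =>
    have h2 : x < N := hN x (by simp)
    have ih := sum_X_pow_descentNumber_cons N x l hN
    -- The split-off term is insertion at the very front, which always creates a descent `N > x`.
    rw [List.length_cons, Finset.sum_range_succ']
    simp only [List.take_succ_cons, List.drop_succ_cons, List.cons_append,
      ih, List.take_zero, List.drop_zero, List.nil_append,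
      descentNumber_cons_cons, h2, if_true, lt_irrefl, if_false]
    push_cast
    ring

theorem append_cons_inj_of_notMem_left {N : ℕ} {a a' b b' : List ℕ} (ha : N ∉ a) (ha' : N ∉ a')
    (h : a ++ N :: b = a' ++ N :: b') : a = a' ∧ b = b' := by
  induction a generalizing a' with
  | nil => cases a' <;> grind
  | cons x a ih => cases a' <;> grind

theorem mem_stirlingPermutations {n : ℕ} {l : List ℕ} :
    l ∈ stirlingPermutations n ↔
      (∀ x, l.count x = if 1 ≤ x ∧ x ≤ n then 2 else 0) ∧ IsStirling l := by
  classical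
  have h : l ∈ stirlingPermutations n ↔
      2 • (Finset.Icc 1 n).val = (l : Multiset ℕ) ∧ IsStirling l := by
    rw [stirlingPermutations, Finset.mem_filter, Multiset.mem_toFinset, Multiset.mem_lists_iff]
    rfl
  rw [h, Multiset.ext]
  refine and_congr_left fun _ => forall_congr' fun x => ?_
  rw [Multiset.coe_count, Multiset.count_nsmul, eq_comm]
  have : Multiset.count x (Finset.Icc 1 n).val = if 1 ≤ x ∧ x ≤ n then 1 else 0 := by
    rw [Multiset.count_eq_of_nodup (Finset.nodup _)]
    simp
  rw [this]
  split_ifs <;> simp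

theorem length_of_mem_stirlingPermutations {n : ℕ} {l : List ℕ}
    (h : l ∈ stirlingPermutations n) : l.length = 2 * n := by
  classical
  rw [stirlingPermutations, Finset.mem_filter, Multiset.mem_toFinset, Multiset.mem_lists_iff] at h
  have := congrArg Multiset.card h.1
  simpa using this.symm

theorem le_of_mem_stirlingPermutations {n : ℕ} {l : List ℕ}
    (h : l ∈ stirlingPermutations n) {x : ℕ} (hx : x ∈ l) : x ≤ n := by
  have h1 := (mem_stirlingPermutations.1 h).1 x
  have := List.count_pos_iff.2 hx
  by_contra hc
  rw [if_neg (by omega)] at h1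
  omega

theorem secondEulerianPolynomial_zero : secondEulerianPolynomial 0 = 1 := by
  have : stirlingPermutations 0 = {[]} := by
    ext l
    rw [mem_stirlingPermutations, Finset.mem_singleton]
    constructor
    · intro h
      rw [List.eq_nil_iff_forall_not_mem]
      intro x hx
      have := h.1 x
      have := List.count_pos_iff.2 hx
      grind
    · rintro rfl
      exact ⟨fun x => by simp; omega, fun i => i.elim0⟩
  simp [secondEulerianPolynomial, this, descentNumber_nil]

/-- Removing the two copies of `n + 1` inverts the insertion; the gap is recovered as the length of
the prefix before the first copy. -/
theorem sum_stirlingPermutations_succ (n : ℕ) (f : List ℕ → ℤ[X]) :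
    ∑ π ∈ stirlingPermutations (n + 1), f π =
      ∑ q ∈ stirlingPermutations n ×ˢ Finset.range (2 * n + 1),
        f (q.1.take q.2 ++ (n + 1) :: (n + 1) :: q.1.drop q.2) := by
  symm
  refine Finset.sum_bij
    (fun q _ => q.1.take q.2 ++ (n + 1) :: (n + 1) :: q.1.drop q.2) ?_ ?_ ?_ (fun _ _ => rfl)
  · rintro ⟨l, p⟩ hq
    have hl := (Finset.mem_product.1 hq).1
    have hlt : ∀ x ∈ l.take p ++ l.drop p, x < n + 1 := fun x hx =>
      Nat.lt_succ_of_le (le_of_mem_stirlingPermutations hl (by simpa using hx))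
    rw [mem_stirlingPermutations]
    refine ⟨fun x => ?_, IsStirling.insert_pair
      (by simpa using (mem_stirlingPermutations.1 hl).2) hlt⟩
    have h1 := (mem_stirlingPermutations.1 hl).1 x
    have h2 : (l.take p).count x + (l.drop p).count x = l.count x := by
      rw [← List.count_append, List.take_append_drop]
    simp only [List.count_append, List.count_cons]
    grind
  · rintro ⟨l, p⟩ hq ⟨l', p'⟩ hq' he
    have hl := Finset.mem_product.1 hq
    have hl' := Finset.mem_product.1 hq'
    have e : ∀ {m : List ℕ}, m ∈ stirlingPermutations n → n + 1 ∉ m := fun hm hx => by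
      have := le_of_mem_stirlingPermutations hm hx
      omega
    dsimp only at he hl hl'
    have ht : ∀ {m : List ℕ} {p : ℕ}, m ∈ stirlingPermutations n → n + 1 ∉ m.take p :=
      fun hm hx => e hm (List.mem_of_mem_take hx)
    obtain ⟨h1, h2⟩ : l.take p = l'.take p' ∧ l.drop p = l'.drop p' := by
      have := append_cons_inj_of_notMem_left (ht hl.1) (ht hl'.1) he
      exact ⟨this.1, (List.cons.inj this.2).2⟩
    have h3 := congrArg List.length h1
    rw [List.length_take, List.length_take, length_of_mem_stirlingPermutations hl.1,
      length_of_mem_stirlingPermutations hl'.1] at h3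
    have h4 := Finset.mem_range.1 hl.2
    have h5 := Finset.mem_range.1 hl'.2
    rw [Prod.mk.injEq]
    refine ⟨?_, by omega⟩
    rw [← List.take_append_drop p l, h1, h2, List.take_append_drop]
  · intro π hπ
    have hπ' := mem_stirlingPermutations.1 hπ
    obtain ⟨a, b, rfl, ha, hb⟩ := hπ'.2.exists_insert_pair
      (fun x hx => le_of_mem_stirlingPermutations hπ hx) (by simp [hπ'.1])
    have hab : a ++ b ∈ stirlingPermutations n := by
      rw [mem_stirlingPermutations]
      constructor
      · intro x
        have := hπ'.1 x
        simp only [List.count_append, List.count_cons] at this ⊢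
        have h1 := List.count_eq_zero.2 ha
        have h2 := List.count_eq_zero.2 hb
        grind
      · have := hπ'.2
        rw [isStirling_iff_sublist] at this ⊢
        intro x y hs
        refine this x y (hs.trans ?_)
        refine (List.Sublist.refl a).append ?_
        exact (List.sublist_cons_self _ _).trans (List.sublist_cons_self _ _)
    have hlen := length_of_mem_stirlingPermutations hab
    rw [List.length_append] at hlen
    exact ⟨(a ++ b, a.length), Finset.mem_product.2 ⟨hab, Finset.mem_range.2 (by simp; omega)⟩,
      by simp⟩

theorem secondEulerianPolynomial_succ (n : ℕ) :
    secondEulerianPolynomial (n + 1) =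
      (1 + 2 * (n : ℤ[X]) * X) * secondEulerianPolynomial n +
        X * (1 - X) * derivative (secondEulerianPolynomial n) := by
  rw [secondEulerianPolynomial, sum_stirlingPermutations_succ, Finset.sum_product,
    secondEulerianPolynomial, derivative_sum, Finset.mul_sum, Finset.mul_sum,
    ← Finset.sum_add_distrib]
  refine Finset.sum_congr rfl fun l hl => ?_
  have hlen := length_of_mem_stirlingPermutations hl
  have := sum_X_pow_descentNumber (n + 1) l
    (fun x hx => Nat.lt_succ_of_le (le_of_mem_stirlingPermutations hl hx))
  rw [hlen] at this
  simp only [this]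
  rw [derivative_X_pow]
  rcases descentNumber l with _ | d
  · simp
  · simp; ring

/-! ### Laminar families as leaf-labelled trees, and their enumeration by leaf deletion. -/

section Laminar
variable {α : Type*}

/-- A laminar family on `s` which contains `s` and all singletons: the vertex sets below the nodes
of a rooted tree with leaf set `s` in which no node has exactly one child. -/
structure IsFullLaminar (s : Finset α) (F : Finset (Finset α)) : Prop where
  nonempty : ∀ A ∈ F, A.Nonempty
  subset : ∀ A ∈ F, A ⊆ s
  singleton_mem : ∀ x ∈ s, {x} ∈ F
  top_mem : s ∈ F
  laminar : ∀ A ∈ F, ∀ B ∈ F, A ⊆ B ∨ B ⊆ A ∨ Disjoint A B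

open Classical in
/-- The full laminar families on `s` with `k` members. -/
noncomputable def fullLaminar (s : Finset α) (k : ℕ) : Finset (Finset (Finset α)) :=
  {F ∈ s.powerset.powerset | IsFullLaminar s F ∧ F.card = k}

theorem mem_fullLaminar {s : Finset α} {k : ℕ} {F : Finset (Finset α)} :
    F ∈ fullLaminar s k ↔ IsFullLaminar s F ∧ F.card = k := by
  classical
  rw [fullLaminar, Finset.mem_filter, and_iff_right_iff_imp]
  intro h
  rw [Finset.mem_powerset]
  intro A hA
  exact Finset.mem_powerset.2 (h.1.subset A hA)

variable [DecidableEq α]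

/-- The result of attaching the leaf `v` to the node `N`. -/
def attachLeaf (v : α) (N : Finset α) (F : Finset (Finset α)) : Finset (Finset α) :=
  insert {v} (F.image fun A => if N ⊆ A then insert v A else A)

/-- The result of deleting the leaf `v`. -/
def deleteLeaf (v : α) (F : Finset (Finset α)) : Finset (Finset α) :=
  (F.image fun A => A.erase v).erase ∅

theorem mem_attachLeaf {v : α} {N : Finset α} {F : Finset (Finset α)} {B : Finset α} :
    B ∈ attachLeaf v N F ↔ B = {v} ∨ (∃ A ∈ F, N ⊆ A ∧ B = insert v A) ∨ (B ∈ F ∧ ¬ N ⊆ B) := by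
  simp only [attachLeaf, Finset.mem_insert, Finset.mem_image]
  grind

theorem mem_deleteLeaf {v : α} {F : Finset (Finset α)} {A : Finset α} :
    A ∈ deleteLeaf v F ↔ A.Nonempty ∧ ∃ B ∈ F, B.erase v = A := by
  simp [deleteLeaf, Finset.nonempty_iff_ne_empty]

variable {s : Finset α} {v : α} {F : Finset (Finset α)} {N : Finset α}

namespace IsFullLaminar

omit [DecidableEq α] in
theorem notMem_of_mem (hF : IsFullLaminar s F) (hv : v ∉ s) {A : Finset α} (hA : A ∈ F) : v ∉ A :=
  fun h => hv (hF.subset A hA h)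

theorem card_attachLeaf (hF : IsFullLaminar s F) (hv : v ∉ s) :
    (attachLeaf v N F).card = F.card + 1 := by
  rw [attachLeaf, Finset.card_insert_of_notMem, Finset.card_image_of_injOn]
  · intro A hA B hB h
    have h1 := hF.notMem_of_mem hv hA
    have h2 := hF.notMem_of_mem hv hB
    dsimp only at h
    have : ∀ C : Finset α, v ∉ C → (if N ⊆ C then insert v C else C).erase v = C := by
      intro C hC
      split_ifs
      · exact Finset.erase_insert hC
      · exact Finset.erase_eq_of_notMem hC
    rw [← this A h1, ← this B h2, h]
  · intro h
    obtain ⟨A, hA, h⟩ := Finset.mem_image.1 h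
    have h1 := hF.notMem_of_mem hv hA
    obtain ⟨x, hx⟩ := hF.nonempty A hA
    have h2 : x ∈ ({v} : Finset α) := by rw [← h]; split_ifs <;> simp [hx]
    have := Finset.mem_singleton.1 h2
    exact h1 (this ▸ hx)

theorem notMem_attachLeaf (hF : IsFullLaminar s F) (hv : v ∉ s) (hN : N ∈ F) :
    N ∉ attachLeaf v N F := by
  rw [mem_attachLeaf]
  have := hF.notMem_of_mem hv hN
  rintro (h | ⟨A, hA, h, h'⟩ | h)
  · simp [h] at this
  · simp [h'] at this
  · exact h.2 le_rfl

/-- `attachLeaf` replaces `N` by `insert v N`. Putting `N` back makes `insert v N` a new node whose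
children are `N` and the leaf `v`; this is allowed for every node, leaves and root included. -/
theorem insert_attachLeaf (hF : IsFullLaminar s F) (hv : v ∉ s) (hN : N ∈ F) :
    IsFullLaminar (insert v s) (insert N (attachLeaf v N F)) := by
  have hs := hF.subset
  have hne := hF.nonempty
  have hl := hF.laminar
  obtain ⟨y, hy⟩ := hne N hN
  have hvF : ∀ A ∈ F, v ∉ A := fun A => hF.notMem_of_mem hv
  constructor
  · intro A hA
    rw [Finset.mem_insert, mem_attachLeaf] at hA
    rcases hA with rfl | rfl | ⟨A, hA, h, rfl⟩ | h
    · exact hne _ hN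
    · simp
    · simp
    · exact hne _ h.1
  · intro A hA
    rw [Finset.mem_insert, mem_attachLeaf] at hA
    rcases hA with rfl | rfl | ⟨A, hA, h, rfl⟩ | h
    · exact (hs _ hN).trans (Finset.subset_insert _ _)
    · simp
    · exact Finset.insert_subset_insert _ (hs _ hA)
    · exact (hs _ h.1).trans (Finset.subset_insert _ _)
  · intro x hx
    rw [Finset.mem_insert, mem_attachLeaf]
    rcases Finset.mem_insert.1 hx with rfl | hx
    · simp
    · have h1 := hF.singleton_mem x hx
      by_cases h : N ⊆ {x}
      · left
        exact (((hne N hN).subset_singleton_iff).1 h).symm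
      · exact Or.inr (Or.inr (Or.inr ⟨h1, h⟩))
  · rw [Finset.mem_insert, mem_attachLeaf]
    exact Or.inr (Or.inr (Or.inl ⟨s, hF.top_mem, hs N hN, rfl⟩))
  · have key : ∀ A ∈ F, ∀ B ∈ F, N ⊆ A → ¬ N ⊆ B → B ⊆ insert v A ∨ Disjoint B (insert v A) := by
      intro A hA B hB h1 h2
      rcases hl A hA B hB with h | h | h
      · exact absurd (h1.trans h) h2
      · exact Or.inl (h.trans (Finset.subset_insert _ _))
      · right
        rw [Finset.disjoint_insert_right]
        exact ⟨hvF B hB, h.symm⟩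
    have hdv : ∀ A ∈ F, Disjoint A {v} := fun A hA => Finset.disjoint_singleton_right.2 (hvF A hA)
    intro A hA B hB
    rw [Finset.mem_insert, mem_attachLeaf] at hA hB
    rcases hA with rfl | rfl | ⟨A, hA, h, rfl⟩ | h
    · rcases hB with rfl | rfl | ⟨B, hB, h', rfl⟩ | h'
      · simp
      · exact Or.inr (Or.inr (hdv _ hN))
      · exact Or.inl (h'.trans (Finset.subset_insert _ _))
      · exact hl _ hN _ h'.1
    · rcases hB with rfl | rfl | ⟨B, hB, h', rfl⟩ | h'
      · exact Or.inr (Or.inr (hdv _ hN).symm)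
      · simp
      · simp
      · exact Or.inr (Or.inr (hdv _ h'.1).symm)
    · rcases hB with rfl | rfl | ⟨B, hB, h', rfl⟩ | h'
      · exact Or.inr (Or.inl (h.trans (Finset.subset_insert _ _)))
      · simp
      · rcases hl A hA B hB with g | g | g
        · exact Or.inl (Finset.insert_subset_insert _ g)
        · exact Or.inr (Or.inl (Finset.insert_subset_insert _ g))
        · exact absurd (h' hy) (Finset.disjoint_left.1 g (h hy))
      · rcases key A hA B h'.1 h h'.2 with g | g
        · exact Or.inr (Or.inl g)
        · exact Or.inr (Or.inr g.symm)
    · rcases hB with rfl | rfl | ⟨B, hB, h', rfl⟩ | h'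
      · exact hl _ h.1 _ hN
      · exact Or.inr (Or.inr (hdv _ h.1))
      · rcases key B hB A h.1 h' h.2 with g | g
        · exact Or.inl g
        · exact Or.inr (Or.inr g)
      · exact hl _ h.1 _ h'.1

/-- Here `v` becomes a further child of `N`. A leaf `N` is excluded because its singleton would
disappear from the family. -/
theorem attachLeaf (hF : IsFullLaminar s F) (hv : v ∉ s) (hN : N ∈ F) (h1 : 1 < N.card) :
    IsFullLaminar (insert v s) (attachLeaf v N F) := by
  have h := hF.insert_attachLeaf hv hN
  refine ⟨fun A hA => h.nonempty A (Finset.mem_insert_of_mem hA),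
    fun A hA => h.subset A (Finset.mem_insert_of_mem hA), fun x hx => ?_, ?_,
    fun A hA B hB => h.laminar A (Finset.mem_insert_of_mem hA) B (Finset.mem_insert_of_mem hB)⟩
  · rcases Finset.mem_insert.1 (h.singleton_mem x hx) with g | g
    · rw [← g] at h1; simp at h1
    · exact g
  · rcases Finset.mem_insert.1 h.top_mem with g | g
    · exact absurd (g ▸ Finset.mem_insert_self v s) (hF.notMem_of_mem hv hN)
    · exact g

theorem deleteLeaf (hF : IsFullLaminar (insert v s) F) (hv : v ∉ s) (hs : s.Nonempty) :
    IsFullLaminar s (deleteLeaf v F) := by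
  constructor
  · intro A hA
    exact (mem_deleteLeaf.1 hA).1
  · intro A hA
    obtain ⟨-, B, hB, rfl⟩ := mem_deleteLeaf.1 hA
    exact Finset.subset_insert_iff.1 (hF.subset B hB)
  · intro x hx
    refine mem_deleteLeaf.2 ⟨by simp, {x}, hF.singleton_mem x (Finset.mem_insert_of_mem hx), ?_⟩
    refine Finset.erase_eq_of_notMem ?_
    rw [Finset.mem_singleton]
    rintro rfl
    exact hv hx
  · exact mem_deleteLeaf.2 ⟨hs, _, hF.top_mem, Finset.erase_insert hv⟩
  · intro A hA B hB
    obtain ⟨-, A, hA', rfl⟩ := mem_deleteLeaf.1 hA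
    obtain ⟨-, B, hB', rfl⟩ := mem_deleteLeaf.1 hB
    rcases hF.laminar A hA' B hB' with h | h | h
    · exact Or.inl (Finset.erase_subset_erase _ h)
    · exact Or.inr (Or.inl (Finset.erase_subset_erase _ h))
    · exact Or.inr (Or.inr (h.mono (Finset.erase_subset _ _) (Finset.erase_subset _ _)))

theorem deleteLeaf_attachLeaf (hF : IsFullLaminar s F) (hv : v ∉ s) :
    _root_.deleteLeaf v (_root_.attachLeaf v N F) = F := by
  ext A
  rw [mem_deleteLeaf]
  constructor
  · rintro ⟨hne, B, hB, rfl⟩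
    rcases mem_attachLeaf.1 hB with rfl | ⟨C, hC, h, rfl⟩ | h
    · simp at hne
    · rwa [Finset.erase_insert (hF.notMem_of_mem hv hC)]
    · rw [Finset.erase_eq_of_notMem (hF.notMem_of_mem hv h.1)]
      exact h.1
  · intro hA
    refine ⟨hF.nonempty A hA, ?_⟩
    by_cases h : N ⊆ A
    · exact ⟨insert v A, mem_attachLeaf.2 (Or.inr (Or.inl ⟨A, hA, h, rfl⟩)),
        Finset.erase_insert (hF.notMem_of_mem hv hA)⟩
    · exact ⟨A, mem_attachLeaf.2 (Or.inr (Or.inr ⟨hA, h⟩)),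
        Finset.erase_eq_of_notMem (hF.notMem_of_mem hv hA)⟩

theorem deleteLeaf_insert_attachLeaf (hF : IsFullLaminar s F) (hv : v ∉ s) (hN : N ∈ F) :
    _root_.deleteLeaf v (insert N (_root_.attachLeaf v N F)) = F := by
  conv_rhs => rw [← hF.deleteLeaf_attachLeaf (N := N) hv]
  ext A
  rw [hF.deleteLeaf_attachLeaf hv, mem_deleteLeaf]
  constructor
  · rintro ⟨hne, B, hB, rfl⟩
    rcases Finset.mem_insert.1 hB with rfl | hB
    · rwa [Finset.erase_eq_of_notMem (hF.notMem_of_mem hv hN)]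
    · rw [← hF.deleteLeaf_attachLeaf (N := N) hv]
      exact mem_deleteLeaf.2 ⟨hne, B, hB, rfl⟩
  · intro hA
    rw [← hF.deleteLeaf_attachLeaf (N := N) hv, mem_deleteLeaf] at hA
    obtain ⟨h, B, hB, h'⟩ := hA
    exact ⟨h, B, Finset.mem_insert_of_mem hB, h'⟩

/-- Used in both directions to recover the attaching node: `insert v N` is the parent of the leaf
`v`, the smallest member properly containing `{v}`. -/
theorem subset_of_insert_mem (hF : IsFullLaminar s F) (hv : v ∉ s) {N N' : Finset α}
    (hN : N ∈ F) (hN' : N' ∈ F) 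
    (h : insert v N ∈ insert N' (_root_.attachLeaf v N' F)) : N' ⊆ N := by
  have hvN := hF.notMem_of_mem hv hN
  rcases Finset.mem_insert.1 h with h | h
  · exact absurd (h ▸ Finset.mem_insert_self v N) (hF.notMem_of_mem hv hN')
  rcases mem_attachLeaf.1 h with h | ⟨A, hA, h, h'⟩ | h
  · obtain ⟨x, hx⟩ := hF.nonempty N hN
    have : x ∈ ({v} : Finset α) := h ▸ Finset.mem_insert_of_mem hx
    rw [Finset.mem_singleton] at this
    exact absurd (this ▸ hx) hvN
  · have := congrArg (fun B => Finset.erase B v) h'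
    simp only [Finset.erase_insert hvN, Finset.erase_insert (hF.notMem_of_mem hv hA)] at this
    rwa [this]
  · exact absurd (Finset.mem_insert_self v N) (hF.notMem_of_mem hv h.1)

theorem insert_mem_attachLeaf (hN : N ∈ F) : insert v N ∈ _root_.attachLeaf v N F :=
  mem_attachLeaf.2 (Or.inr (Or.inl ⟨N, hN, le_rfl, rfl⟩))

/-- Let `M` be the parent of `v`. Whether `M.erase v` is itself a member says whether `v` has a
single sibling, so that `M` vanishes together with `v`, or several, so that `M` survives as `M.erase
v`. -/
theorem exists_eq_attachLeaf (hF : IsFullLaminar (insert v s) F) (hv : v ∉ s) (hs : s.Nonempty) :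
    ∃ N ∈ _root_.deleteLeaf v F, (N ∈ F ∧ F = insert N (_root_.attachLeaf v N (_root_.deleteLeaf v F))) ∨
      (N ∉ F ∧ 1 < N.card ∧ F = _root_.attachLeaf v N (_root_.deleteLeaf v F)) := by
  obtain ⟨M, hM, hmin⟩ := Finset.exists_min_image (F.filter fun B => v ∈ B ∧ B ≠ {v})
    Finset.card ⟨insert v s, by
      rw [Finset.mem_filter]
      refine ⟨hF.top_mem, Finset.mem_insert_self _ _, fun h => ?_⟩
      obtain ⟨x, hx⟩ := hs
      have : x ∈ ({v} : Finset α) := h ▸ Finset.mem_insert_of_mem hx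
      rw [Finset.mem_singleton] at this
      exact hv (this ▸ hx)⟩
  rw [Finset.mem_filter] at hM
  obtain ⟨hMF, hvM, hMv⟩ := hM
  have hsub : ∀ B ∈ F, v ∈ B → B ≠ {v} → M ⊆ B := by
    intro B hB hvB hBv
    have hc := hmin B (Finset.mem_filter.2 ⟨hB, hvB, hBv⟩)
    rcases hF.laminar M hMF B hB with h | h | h
    · exact h
    · exact (Finset.eq_of_subset_of_card_le h hc).ge
    · exact absurd hvB (Finset.disjoint_left.1 h hvM)
  have hN : (M.erase v).Nonempty := by
    rw [Finset.nonempty_iff_ne_empty, Ne, Finset.erase_eq_empty_iff]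
    rintro (h | h)
    · simp [h] at hvM
    · exact hMv h
  have hNM : insert v (M.erase v) = M := Finset.insert_erase hvM
  -- Only `M.erase v` can lie above `M.erase v` and avoid `v`, since by laminarity such a member
  -- sits inside `M`.
  have huniq : ∀ B ∈ F, v ∉ B → M.erase v ⊆ B → B = M.erase v := by
    intro B hB hvB hNB
    obtain ⟨x, hx⟩ := hN
    rcases hF.laminar M hMF B hB with h | h | h
    · exact absurd (h hvM) hvB
    · exact (Finset.subset_erase.2 ⟨h, hvB⟩).antisymm hNB
    · exact absurd (hNB hx) (Finset.disjoint_left.1 h (Finset.mem_of_mem_erase hx))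
  have hNd : M.erase v ∈ _root_.deleteLeaf v F := mem_deleteLeaf.2 ⟨hN, M, hMF, rfl⟩
  have h1 : ∀ B ∈ F, B = M.erase v ∨ B ∈ _root_.attachLeaf v (M.erase v) (_root_.deleteLeaf v F) := by
    intro B hB
    rw [mem_attachLeaf]
    by_cases hBv : B = {v}
    · exact Or.inr (Or.inl hBv)
    by_cases hvB : v ∈ B
    · right; right; left
      have hs := Finset.erase_subset_erase v (hsub B hB hvB hBv)
      exact ⟨B.erase v, mem_deleteLeaf.2 ⟨hN.mono hs, B, hB, rfl⟩, hs,
        (Finset.insert_erase hvB).symm⟩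
    · by_cases hNB : M.erase v ⊆ B
      · exact Or.inl (huniq B hB hvB hNB)
      · exact Or.inr (Or.inr (Or.inr ⟨mem_deleteLeaf.2
          ⟨hF.nonempty B hB, B, hB, Finset.erase_eq_of_notMem hvB⟩, hNB⟩))
  have h2 : ∀ B ∈ _root_.attachLeaf v (M.erase v) (_root_.deleteLeaf v F), B ∈ F := by
    intro B hB
    rcases mem_attachLeaf.1 hB with rfl | ⟨A, hA, h, rfl⟩ | ⟨hB, h⟩
    · exact hF.singleton_mem v (Finset.mem_insert_self _ _)
    · obtain ⟨hne, C, hC, rfl⟩ := mem_deleteLeaf.1 hA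
      by_cases hvC : v ∈ C
      · rwa [Finset.insert_erase hvC]
      · rw [Finset.erase_eq_of_notMem hvC] at h ⊢
        rwa [huniq C hC hvC h, hNM]
    · obtain ⟨hne, C, hC, rfl⟩ := mem_deleteLeaf.1 hB
      by_cases hvC : v ∈ C
      · refine absurd (Finset.erase_subset_erase v (hsub C hC hvC ?_)) h
        rintro rfl
        simp at hne
      · rwa [Finset.erase_eq_of_notMem hvC]
  refine ⟨M.erase v, hNd, ?_⟩
  by_cases hNF : M.erase v ∈ F
  · left
    refine ⟨hNF, ?_⟩
    ext B
    rw [Finset.mem_insert]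
    refine ⟨h1 B, ?_⟩
    rintro (rfl | h)
    · exact hNF
    · exact h2 B h
  · right
    refine ⟨hNF, ?_, ?_⟩
    · by_contra hc
      have : (M.erase v).card = 1 := le_antisymm (not_lt.1 hc) hN.card_pos
      obtain ⟨x, hx⟩ := Finset.card_eq_one.1 this
      apply hNF
      rw [hx]
      apply hF.singleton_mem
      apply hF.subset M hMF
      exact Finset.mem_of_mem_erase (hx ▸ Finset.mem_singleton_self x)
    · ext B
      refine ⟨fun hB => (h1 B hB).resolve_left ?_, h2 B⟩
      rintro rfl
      exact hNF hB

omit [DecidableEq α] in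
theorem card_filter_one_lt (hF : IsFullLaminar s F) :
    (F.filter fun N => 1 < N.card).card + s.card = F.card := by
  classical
  rw [← Finset.card_filter_add_card_filter_not (s := F) (fun N => 1 < N.card)]
  congr 1
  have : F.filter (fun N => ¬ 1 < N.card) = s.map ⟨fun x => {x}, Finset.singleton_injective⟩ := by
    ext A
    rw [Finset.mem_filter, Finset.mem_map]
    constructor
    · rintro ⟨hA, hc⟩
      obtain ⟨x, rfl⟩ := Finset.card_eq_one.1
        (le_antisymm (not_lt.1 hc) (hF.nonempty A hA).card_pos)
      exact ⟨x, by simpa using hF.subset _ hA, rfl⟩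
    · rintro ⟨x, hx, rfl⟩
      exact ⟨hF.singleton_mem x hx, by simp⟩
  rw [this, Finset.card_map]

end IsFullLaminar

/-- The first term attaches `v` to one of the `j + 1` internal nodes of a smaller tree, adding one
node. The second creates a new parent for `v` and any one of the `s.card + j` nodes, adding two. -/
theorem card_fullLaminar_insert (hv : v ∉ s) (hs : s.Nonempty) (j : ℕ) :
    (fullLaminar (insert v s) (s.card + j + 2)).card =
      (j + 1) * (fullLaminar s (s.card + j + 1)).card +
        (s.card + j) * (fullLaminar s (s.card + j)).card := by
  classical
  have hsplit := Finset.card_filter_add_card_filter_not (s := fullLaminar (insert v s) (s.card + j + 2))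
    (fun F => ∃ N ∈ F, N ∈ deleteLeaf v F ∧ F = insert N (attachLeaf v N (deleteLeaf v F)))
  have c1 : ((fullLaminar s (s.card + j + 1)).sigma fun F => F.filter fun N => 1 < N.card).card =
      (j + 1) * (fullLaminar s (s.card + j + 1)).card := by
    rw [Finset.card_sigma, Finset.sum_const_nat (m := j + 1), mul_comm]
    intro F hF
    have h := mem_fullLaminar.1 hF
    have := h.1.card_filter_one_lt
    omega
  have c2 : ((fullLaminar s (s.card + j)).sigma fun F => F).card =
      (s.card + j) * (fullLaminar s (s.card + j)).card := by
    rw [Finset.card_sigma, Finset.sum_const_nat (m := s.card + j), mul_comm]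
    intro F hF
    exact (mem_fullLaminar.1 hF).2
  rw [← hsplit, ← c1, ← c2, add_comm]
  congr 1
  · symm
    refine Finset.card_bij (fun q _ => attachLeaf v q.2 q.1) ?_ ?_ ?_
    · rintro ⟨F, N⟩ hq
      rw [Finset.mem_sigma, mem_fullLaminar, Finset.mem_filter] at hq
      obtain ⟨⟨hF, hc⟩, hN, h1⟩ := hq
      dsimp only at hF hc hN h1 ⊢
      rw [Finset.mem_filter, mem_fullLaminar, hF.card_attachLeaf hv, hc,
        hF.deleteLeaf_attachLeaf hv]
      refine ⟨⟨hF.attachLeaf hv hN h1, rfl⟩, ?_⟩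
      rintro ⟨N', -, hN', h⟩
      -- Both constructions start from the same smaller tree, but their results differ in size by
      -- one.
      have := congrArg Finset.card h
      rw [Finset.card_insert_of_notMem (hF.notMem_attachLeaf hv hN'), hF.card_attachLeaf hv,
        hF.card_attachLeaf hv] at this
      omega
    · rintro ⟨F, N⟩ hq ⟨F', N'⟩ hq' h
      rw [Finset.mem_sigma, mem_fullLaminar, Finset.mem_filter] at hq hq'
      obtain ⟨⟨hF, hc⟩, hN, h1⟩ := hq
      obtain ⟨⟨hF', hc'⟩, hN', h1'⟩ := hq'
      dsimp only at hF hF' hN hN' h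
      obtain rfl : F = F' := by
        rw [← hF.deleteLeaf_attachLeaf (N := N) hv, h, hF'.deleteLeaf_attachLeaf hv]
      obtain rfl : N = N' := (hF.subset_of_insert_mem hv hN' hN (Finset.mem_insert_of_mem
          (h ▸ IsFullLaminar.insert_mem_attachLeaf hN'))).antisymm
        (hF.subset_of_insert_mem hv hN hN' (Finset.mem_insert_of_mem
          (h ▸ IsFullLaminar.insert_mem_attachLeaf hN)))
      rfl
    · intro F hF
      rw [Finset.mem_filter, mem_fullLaminar] at hF
      obtain ⟨⟨hF, hc⟩, hn⟩ := hF
      have hD := hF.deleteLeaf hv hs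
      obtain ⟨N, hN, h | h⟩ := hF.exists_eq_attachLeaf hv hs
      · exact absurd ⟨N, h.1, hN, h.2⟩ hn
      · refine ⟨⟨deleteLeaf v F, N⟩, ?_, h.2.2.symm⟩
        rw [Finset.mem_sigma, mem_fullLaminar, Finset.mem_filter]
        refine ⟨⟨hD, ?_⟩, hN, h.2.1⟩
        have := hD.card_attachLeaf (N := N) hv
        rw [← h.2.2] at this
        dsimp only
        omega
  · symm
    refine Finset.card_bij (fun q _ => insert q.2 (attachLeaf v q.2 q.1)) ?_ ?_ ?_
    · rintro ⟨F, N⟩ hq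
      rw [Finset.mem_sigma, mem_fullLaminar] at hq
      obtain ⟨⟨hF, hc⟩, hN⟩ := hq
      dsimp only at hF hc hN ⊢
      rw [Finset.mem_filter, mem_fullLaminar,
        Finset.card_insert_of_notMem (hF.notMem_attachLeaf hv hN), hF.card_attachLeaf hv, hc,
        hF.deleteLeaf_insert_attachLeaf hv hN]
      exact ⟨⟨hF.insert_attachLeaf hv hN, rfl⟩, N, Finset.mem_insert_self _ _, hN, rfl⟩
    · rintro ⟨F, N⟩ hq ⟨F', N'⟩ hq' h
      rw [Finset.mem_sigma, mem_fullLaminar] at hq hq'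
      obtain ⟨⟨hF, hc⟩, hN⟩ := hq
      obtain ⟨⟨hF', hc'⟩, hN'⟩ := hq'
      dsimp only at hF hF' hN hN' h
      obtain rfl : F = F' := by
        rw [← hF.deleteLeaf_insert_attachLeaf hv hN, h, hF'.deleteLeaf_insert_attachLeaf hv hN']
      obtain rfl : N = N' := (hF.subset_of_insert_mem hv hN' hN
          (h ▸ Finset.mem_insert_of_mem (IsFullLaminar.insert_mem_attachLeaf hN'))).antisymm
        (hF.subset_of_insert_mem hv hN hN'
          (h ▸ Finset.mem_insert_of_mem (IsFullLaminar.insert_mem_attachLeaf hN)))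
      rfl
    · intro F hF
      rw [Finset.mem_filter, mem_fullLaminar] at hF
      obtain ⟨⟨hF, hc⟩, N, hNF, hN, h⟩ := hF
      have hD := hF.deleteLeaf hv hs
      refine ⟨⟨deleteLeaf v F, N⟩, ?_, h.symm⟩
      rw [Finset.mem_sigma, mem_fullLaminar]
      refine ⟨⟨hD, ?_⟩, hN⟩
      have := congrArg Finset.card h
      rw [Finset.card_insert_of_notMem (hD.notMem_attachLeaf hv hN), hD.card_attachLeaf hv]
        at this
      dsimp only
      omega

/-- The number of rooted trees with `n + 1` labelled leaves and `j` further nodes, each of which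
has at least two children. -/
def wardNumber : ℕ → ℕ → ℕ
  | 0, 0 => 1
  | 0, _ + 1 => 0
  | _ + 1, 0 => 0
  | n + 1, j + 1 => (j + 1) * wardNumber n (j + 1) + (n + 1 + j) * wardNumber n j

theorem wardNumber_eq_zero {n j : ℕ} (h : n < j) : wardNumber n j = 0 := by
  induction n generalizing j with
  | zero => cases j with
    | zero => omega
    | succ j => rfl
  | succ n ih => cases j with
    | zero => rfl
    | succ j => rw [wardNumber, ih (by omega), ih (by omega), mul_zero, mul_zero, add_zero]

theorem wardNumber_self_pos (n : ℕ) : 0 < wardNumber n n := by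
  induction n with
  | zero => simp [wardNumber]
  | succ n ih => rw [wardNumber]; positivity

theorem card_fullLaminar (n : ℕ) (s : Finset α) (hs : s.card = n + 1) (j : ℕ) :
    (fullLaminar s (n + 1 + j)).card = wardNumber n j := by
  induction n generalizing s j with
  | zero =>
    obtain ⟨x, rfl⟩ := Finset.card_eq_one.1 hs
    have hu : ∀ F, IsFullLaminar {x} F → F = {{x}} := by
      intro F hF
      refine Finset.Subset.antisymm (fun A hA => ?_) (by simpa using hF.top_mem)
      rw [Finset.mem_singleton, ← (hF.nonempty A hA).subset_singleton_iff]
      exact hF.subset A hA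
    cases j with
    | zero =>
      have : fullLaminar {x} (0 + 1 + 0) = {{{x}}} := by
        ext F
        rw [mem_fullLaminar, Finset.mem_singleton]
        refine ⟨fun h => hu F h.1, ?_⟩
        rintro rfl
        refine ⟨⟨?_, ?_, ?_, ?_, ?_⟩, ?_⟩ <;> simp
      rw [this]; rfl
    | succ j =>
      rw [wardNumber, Finset.card_eq_zero, Finset.eq_empty_iff_forall_notMem]
      intro F hF
      rw [mem_fullLaminar] at hF
      have := hF.2
      rw [hu F hF.1, Finset.card_singleton] at this
      omega
  | succ n ih =>
    obtain ⟨v, t, hv, rfl, ht⟩ := Finset.card_eq_succ.1 hs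
    have hne : t.Nonempty := Finset.card_pos.1 (by omega)
    cases j with
    | zero =>
      rw [wardNumber, Finset.card_eq_zero, Finset.eq_empty_iff_forall_notMem]
      intro F hF
      rw [mem_fullLaminar] at hF
      have h1 := hF.1.card_filter_one_lt
      -- With at least two leaves the root is an internal node, so there are no trees with `j = 0`.
      have h2 : insert v t ∈ F.filter fun N => 1 < N.card :=
        Finset.mem_filter.2 ⟨hF.1.top_mem, by omega⟩
      have := Finset.card_pos.2 ⟨_, h2⟩
      omega
    | succ j =>
      have := card_fullLaminar_insert hv hne j
      rw [ht] at this
      rw [wardNumber, ← ih t ht, ← ih t ht, show n + 1 + 1 + (j + 1) = n + 1 + j + 2 by ring, this,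
        show n + 1 + (j + 1) = n + 1 + j + 1 by ring]

end Laminar

/-! ### Irreducible partitions and nested sets in terms of blocks. -/

section OneBlock
variable {α : Type*}

/-- The partition whose only possibly nontrivial block is `A`. -/
def oneBlock (A : Finset α) : Setoid α where
  r x y := x = y ∨ (x ∈ A ∧ y ∈ A)
  iseqv := ⟨fun _ => Or.inl rfl, by grind, by grind⟩

theorem oneBlock_apply {A : Finset α} {x y : α} : oneBlock A x y ↔ x = y ∨ (x ∈ A ∧ y ∈ A) :=
  Iff.rfl

theorem oneBlock_le {A : Finset α} {r : Setoid α} :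
    oneBlock A ≤ r ↔ ∀ x ∈ A, ∀ y ∈ A, r x y := by
  rw [Setoid.le_def]
  constructor
  · intro h x hx y hy
    exact h (Or.inr ⟨hx, hy⟩)
  · rintro h x y (rfl | ⟨hx, hy⟩)
    · exact r.refl' _
    · exact h x hx y hy

theorem oneBlock_le_oneBlock {A B : Finset α} (hA : 1 < A.card) :
    oneBlock A ≤ oneBlock B ↔ A ⊆ B := by
  rw [oneBlock_le]
  constructor
  · intro h x hx
    obtain ⟨y, hy, hxy⟩ := Finset.exists_mem_ne hA x
    rcases h x hx y hy with h | h
    · exact absurd h.symm hxy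
    · exact h.1
  · intro h x hx y hy
    exact Or.inr ⟨h hx, h hy⟩

theorem oneBlock_ne_bot {A : Finset α} (hA : 1 < A.card) : oneBlock A ≠ ⊥ := by
  intro h
  obtain ⟨x, hx, y, hy, hxy⟩ := Finset.one_lt_card.1 hA
  have h1 : oneBlock A x y := Or.inr ⟨hx, hy⟩
  rw [h] at h1
  exact hxy h1

open Classical in
/-- The union of the nonsingleton blocks of `r`. -/
noncomputable def Setoid.support [Fintype α] (r : Setoid α) : Finset α :=
  {x | ∃ y, y ≠ x ∧ r x y}

theorem support_oneBlock [Fintype α] {A : Finset α} (hA : 1 < A.card) :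
    (oneBlock A).support = A := by
  classical
  ext x
  rw [Setoid.support, Finset.mem_filter]
  constructor
  · rintro ⟨-, y, hy, rfl | h⟩
    · exact absurd rfl hy
    · exact h.1
  · intro hx
    obtain ⟨y, hy, hxy⟩ := Finset.exists_mem_ne hA x
    exact ⟨Finset.mem_univ _, y, hxy, Or.inr ⟨hx, hy⟩⟩

/-- The analogue of the fact that a group is not the union of two proper subgroups: if two
equivalence relations together relate all pairs in `A`, one of them already does. -/
theorem eq_or_eq_of_union_eq {G a b : Setoid α} (ha : a ≤ G) (hb : b ≤ G)
    (h : ∀ x y, G x y → a x y ∨ b x y) (A : Finset α) (hG : G = oneBlock A) : a = G ∨ b = G := by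
  by_contra! hc
  obtain ⟨x, y, hxy, hn⟩ : ∃ x y, G x y ∧ ¬ a x y := by
    by_contra! hh
    exact hc.1 (le_antisymm ha (Setoid.le_def.2 fun {x y} => hh x y))
  obtain ⟨u, v, huv, hn'⟩ : ∃ x y, G x y ∧ ¬ b x y := by
    by_contra! hh
    exact hc.2 (le_antisymm hb (Setoid.le_def.2 fun {x y} => hh x y))
  have hx : x ∈ A ∧ y ∈ A := by
    subst hG
    exact hxy.resolve_left fun e => hn (e ▸ a.refl' _)
  have hu : u ∈ A ∧ v ∈ A := by
    subst hG
    exact huv.resolve_left fun e => hn' (e ▸ b.refl' _)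
  have hA : ∀ x ∈ A, ∀ y ∈ A, a x y ∨ b x y := fun x hx y hy =>
    h x y (hG ▸ Or.inr ⟨hx, hy⟩)
  have as : ∀ {x y}, a x y → a y x := a.symm'
  have bs : ∀ {x y}, b x y → b y x := b.symm'
  have aT : ∀ {x y z}, a x y → a y z → a x z := a.trans'
  have bT : ∀ {x y z}, b x y → b y z → b x z := b.trans'
  have h1 := hA x hx.1 u hu.1
  have h2 := hA x hx.1 v hu.2
  have h3 := hA y hx.2 u hu.1
  have h4 := hA y hx.2 v hu.2
  have h5 := hA x hx.1 y hx.2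
  have h6 := hA u hu.1 v hu.2
  grind

/-- In a product decomposition every atom lies below `(⊤, ⊥)` or `(⊥, ⊤)`, so these two elements
cover all pairs of `G` and one of them equals `G`. The other factor is then a point, and `[⊥, G]`
would inject into a proper subset of itself, against finiteness. -/
theorem oneBlock_mem_minimalBuildingSet [Finite α] {A : Finset α} (hA : 1 < A.card) :
    oneBlock A ∈ minimalBuildingSet (Setoid α) := by
  refine ⟨oneBlock_ne_bot hA, ?_⟩
  rintro ⟨P, Q, hP, hQ, ⟨e⟩⟩
  classical
  have hfin : Finite (Setoid α) := Finite.of_injective (fun r : Setoid α => (r : α → α → Prop))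
    fun r s h => Setoid.ext fun x y => iff_of_eq (congrFun (congrFun h x) y)
  set G := oneBlock A with hG
  let t : Set.Iic G := ⟨G, le_refl G⟩
  let z : Set.Iic G := ⟨⊥, (bot_le : ⊥ ≤ G)⟩
  have ht : ∀ x, x ≤ t := fun x => x.2
  have hz : ∀ x, z ≤ x := fun x => (bot_le : ⊥ ≤ (x : Setoid α))
  let a : Set.Iic G := e.symm ((e t).1, (e z).2)
  let b : Set.Iic G := e.symm ((e z).1, (e t).2)
  have hpair : ∀ x y, G x y → (a : Setoid α) x y ∨ (b : Setoid α) x y := by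
    intro x y hxy
    have hle : oneBlock {x, y} ≤ G := by
      rw [oneBlock_le]
      have h1 := G.symm' hxy
      have h2 := G.refl' x
      have h3 := G.refl' y
      simp only [Finset.mem_insert, Finset.mem_singleton]
      rintro u (rfl | rfl) v (rfl | rfl) <;> assumption
    let p : Set.Iic G := ⟨oneBlock {x, y}, hle⟩
    have hpxy : (p : Setoid α) x y := Or.inr (by simp)
    have hq : e.symm ((e p).1, (e z).2) ≤ p := by
      rw [OrderIso.symm_apply_le]
      exact ⟨le_refl _, (e.monotone (hz p)).2⟩
    -- The first component of the atom `p` is either `p` itself or `⊥`, according to whether it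
    -- relates `x` and `y`.
    by_cases hc : (e.symm ((e p).1, (e z).2) : Setoid α) x y
    · left
      have : e.symm ((e p).1, (e z).2) ≤ a := e.symm.monotone ⟨(e.monotone (ht p)).1, le_refl _⟩
      exact this hc
    · right
      have hb : e.symm ((e p).1, (e z).2) = z := by
        apply Subtype.ext
        refine le_bot_iff.1 (Setoid.le_def.2 fun {u v} huv => ?_)
        have h1 : (p : Setoid α) u v := hq huv
        rcases h1 with rfl | ⟨hu, hv⟩
        · rfl
        · simp only [Finset.mem_insert, Finset.mem_singleton] at hu hv
          rcases hu with rfl | rfl <;> rcases hv with rfl | rfl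
          · rfl
          · exact absurd huv hc
          · exact absurd (Setoid.symm' _ huv) hc
          · rfl
      have hb' : (e p).1 = (e z).1 := by
        rw [OrderIso.symm_apply_eq] at hb
        exact (Prod.ext_iff.1 hb).1
      have : p ≤ b := by
        rw [← e.le_iff_le, OrderIso.apply_symm_apply]
        exact ⟨hb'.le, (e.monotone (ht p)).2⟩
      exact this hpxy
  rcases eq_or_eq_of_union_eq a.2 b.2 hpair A hG with h | h
  · have hat : a = t := Subtype.ext h
    have h2 : (e z).2 = (e t).2 := by
      rw [OrderIso.symm_apply_eq] at hat
      exact (Prod.ext_iff.1 hat).2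
    have hinj : Function.Injective fun x : Set.Iic G => (e x).1 := by
      intro x y hxy
      have hs : ∀ x, (e x).2 = (e z).2 := fun x =>
        le_antisymm (h2 ▸ (e.monotone (ht x)).2) (e.monotone (hz x)).2
      exact e.injective (Prod.ext hxy ((hs x).trans (hs y).symm))
    have := Nat.card_le_card_of_injective _ hinj
    exact absurd (Set.ncard_lt_ncard hP) (not_lt.2 this)
  · have hat : b = t := Subtype.ext h
    have h2 : (e z).1 = (e t).1 := by
      rw [OrderIso.symm_apply_eq] at hat
      exact (Prod.ext_iff.1 hat).1
    have hinj : Function.Injective fun x : Set.Iic G => (e x).2 := by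
      intro x y hxy
      have hs : ∀ x, (e x).1 = (e z).1 := fun x =>
        le_antisymm (h2 ▸ (e.monotone (ht x)).1) (e.monotone (hz x)).1
      exact e.injective (Prod.ext ((hs x).trans (hs y).symm) hxy)
    have := Nat.card_le_card_of_injective _ hinj
    exact absurd (Set.ncard_lt_ncard hQ) (not_lt.2 this)

/-- If `A` is a union of blocks of `G`, then `[⊥, G]` is the product of the intervals below the
restrictions of `G` to `A` and to its complement. -/
theorem nonempty_orderIso_prod {G H K : Setoid α} {A : Set α} (hA : ∀ x y, G x y → (x ∈ A ↔ y ∈ A))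
    (hH : ∀ x y, H x y ↔ x = y ∨ (G x y ∧ x ∈ A)) (hK : ∀ x y, K x y ↔ x = y ∨ (G x y ∧ x ∉ A)) :
    Nonempty (Set.Iic G ≃o Set.Iic H × Set.Iic K) := by
  let f : Set.Iic G → Set.Iic H × Set.Iic K := fun r =>
    (⟨r.1 ⊓ H, (inf_le_right : r.1 ⊓ H ≤ H)⟩, ⟨r.1 ⊓ K, (inf_le_right : r.1 ⊓ K ≤ K)⟩)
  have hf : ∀ r s, f r ≤ f s ↔ r ≤ s := by
    intro r s
    constructor
    · rintro ⟨h1, h2⟩ x y hxy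
      have hG : G x y := r.2 hxy
      by_cases hx : x ∈ A
      · exact (@h1 x y ⟨hxy, (hH x y).2 (Or.inr ⟨hG, hx⟩)⟩).1
      · exact (@h2 x y ⟨hxy, (hK x y).2 (Or.inr ⟨hG, hx⟩)⟩).1
    · intro h
      exact ⟨inf_le_inf_right H h, inf_le_inf_right K h⟩
  have hinj : Function.Injective f := fun r s h =>
    le_antisymm ((hf r s).1 h.le) ((hf s r).1 h.ge)
  have hsurj : Function.Surjective f := by
    rintro ⟨⟨r, hr⟩, ⟨s, hs⟩⟩
    have hr' : ∀ x y, r x y → x = y ∨ (G x y ∧ x ∈ A) := fun x y h => (hH x y).1 (hr h)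
    have hs' : ∀ x y, s x y → x = y ∨ (G x y ∧ x ∉ A) := fun x y h => (hK x y).1 (hs h)
    have rr := r.refl'
    have sr := s.refl'
    have rs : ∀ {x y}, r x y → r y x := r.symm'
    have ss : ∀ {x y}, s x y → s y x := s.symm'
    have rt : ∀ {x y z}, r x y → r y z → r x z := r.trans'
    have st : ∀ {x y z}, s x y → s y z → s x z := s.trans'
    -- The preimage of `(r, s)` is glued from `r` on `A` and `s` off `A`.
    let t : Setoid α :=
      { r := fun x y => (x ∈ A ∧ r x y) ∨ (x ∉ A ∧ s x y)
        iseqv := ⟨fun x => by grind, fun {x y} => by grind, fun {x y z} => by grind⟩ }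
    have htd : ∀ x y, t x y ↔ (x ∈ A ∧ r x y) ∨ (x ∉ A ∧ s x y) := fun x y => Iff.rfl
    have htG : t ≤ G := by
      intro x y h
      have := G.refl' x
      rcases h with h | h
      · rcases hr' x y h.2 with rfl | h'
        · exact this
        · exact h'.1
      · rcases hs' x y h.2 with rfl | h'
        · exact this
        · exact h'.1
    refine ⟨⟨t, htG⟩, Prod.ext (Subtype.ext ?_) (Subtype.ext ?_)⟩
    · refine Setoid.ext fun x y => ?_
      change t x y ∧ H x y ↔ r x y
      rw [htd, hH]
      grind
    · refine Setoid.ext fun x y => ?_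
      change t x y ∧ K x y ↔ s x y
      rw [htd, hK]
      grind
  exact ⟨RelIso.ofSurjective (OrderEmbedding.ofMapLEIff f hf) hsurj⟩

/-- A second nonsingleton block would split `[⊥, G]` into the interval for one block `A` and the
interval for the rest, both proper. -/
theorem exists_oneBlock_of_mem_minimalBuildingSet [Fintype α] {G : Setoid α}
    (hG : G ∈ minimalBuildingSet (Setoid α)) : ∃ A : Finset α, 1 < A.card ∧ G = oneBlock A := by
  classical
  obtain ⟨hbot, hprod⟩ := hG
  obtain ⟨x, y, hxy, hne⟩ : ∃ x y, G x y ∧ x ≠ y := by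
    by_contra! h
    exact hbot (le_bot_iff.1 (Setoid.le_def.2 fun {x y} => h x y))
  let A : Finset α := {z | G x z}
  have hA : ∀ z, z ∈ A ↔ G x z := by simp [A]
  have gr := G.refl'
  have gs : ∀ {x y}, G x y → G y x := G.symm'
  have gt : ∀ {x y z}, G x y → G y z → G x z := G.trans'
  refine ⟨A, Finset.one_lt_card.2 ⟨x, (hA x).2 (gr x), y, (hA y).2 hxy, hne⟩, ?_⟩
  have hle : oneBlock A ≤ G := oneBlock_le.2 fun u hu v hv =>
    gt (gs ((hA u).1 hu)) ((hA v).1 hv)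
  by_contra hc
  let K : Setoid α :=
    { r := fun u v => u = v ∨ (G u v ∧ u ∉ A)
      iseqv := ⟨fun u => by grind, fun {u v} => by grind, fun {u v w} => by grind⟩ }
  have hK : ∀ u v, K u v ↔ u = v ∨ (G u v ∧ u ∉ A) := fun u v => Iff.rfl
  have hKG : K ≤ G := by
    rintro u v (rfl | h)
    · exact gr u
    · exact h.1
  have hKne : ¬ G ≤ K := by
    intro h
    have := (hK x y).1 (h hxy)
    grind
  refine hprod ⟨Set.Iic (oneBlock A), Set.Iic K, ?_, ?_, ?_⟩
  · exact ⟨Set.Iic_subset_Iic.2 hle, fun h => hc (le_antisymm (Set.Iic_subset_Iic.1 h) hle)⟩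
  · exact ⟨Set.Iic_subset_Iic.2 hKG, fun h => hKne (Set.Iic_subset_Iic.1 h)⟩
  · refine nonempty_orderIso_prod (A := A) (fun u v h => ?_) (fun u v => ?_) hK
    · rw [Finset.mem_coe, Finset.mem_coe]
      grind
    · rw [oneBlock_apply, Finset.mem_coe]
      grind

theorem mem_minimalBuildingSet_iff [Fintype α] {G : Setoid α} :
    G ∈ minimalBuildingSet (Setoid α) ↔ 1 < G.support.card ∧ oneBlock G.support = G := by
  constructor
  · intro h
    obtain ⟨A, hA, rfl⟩ := exists_oneBlock_of_mem_minimalBuildingSet h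
    rw [support_oneBlock hA]
    exact ⟨hA, rfl⟩
  · rintro ⟨h, h'⟩
    rw [← h']
    exact oneBlock_mem_minimalBuildingSet h

/-- If two blocks cross, the join is the single block on their union, hence irreducible. In an
antichain of a laminar family the blocks are disjoint, so the join keeps them apart and is not a
single block. -/
theorem isNestedSet_iff [Fintype α] {S : Finset (Setoid α)} :
    IsNestedSet (minimalBuildingSet (Setoid α)) S ↔
      (∀ G ∈ S, G ∈ minimalBuildingSet (Setoid α)) ∧ ∀ G ∈ S, ∀ H ∈ S,
        G.support ⊆ H.support ∨ H.support ⊆ G.support ∨ Disjoint G.support H.support := by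
  classical
  refine and_congr_right fun hS => ?_
  have hS' := fun G hG => mem_minimalBuildingSet_iff.1 (hS G hG)
  have hle : ∀ G ∈ S, ∀ H ∈ S, G ≤ H ↔ G.support ⊆ H.support := by
    intro G hG H hH
    rw [← oneBlock_le_oneBlock (hS' G hG).1, (hS' G hG).2, (hS' H hH).2]
  constructor
  · intro h G hG H hH
    by_contra! hc
    obtain ⟨h1, h2, h3⟩ := hc
    rw [← hle G hG H hH] at h1
    rw [← hle H hH G hG] at h2
    have hne : G ≠ H := fun e => h1 e.le
    refine h {G, H} (by grind) (Finset.card_pair hne).ge ?_ ?_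
    · intro u hu v hv huv
      simp only [Finset.coe_pair, Set.mem_insert_iff, Set.mem_singleton_iff] at hu hv
      rcases hu with rfl | rfl <;> rcases hv with rfl | rfl
      · exact absurd rfl huv
      · exact h1
      · exact h2
      · exact absurd rfl huv
    · obtain ⟨x, hxG, hxH⟩ := Finset.not_disjoint_iff.1 h3
      have : ({G, H} : Finset (Setoid α)).sup id = oneBlock (G.support ∪ H.support) := by
        rw [Finset.sup_insert, Finset.sup_singleton, id, id]
        apply le_antisymm
        · rw [sup_le_iff]
          constructor
          · conv_lhs => rw [← (hS' G hG).2]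
            rw [oneBlock_le_oneBlock (hS' G hG).1]
            exact Finset.subset_union_left
          · conv_lhs => rw [← (hS' H hH).2]
            rw [oneBlock_le_oneBlock (hS' H hH).1]
            exact Finset.subset_union_right
        · have key : ∀ y ∈ G.support ∪ H.support, (G ⊔ H) y x := by
            intro y hy
            rcases Finset.mem_union.1 hy with hy | hy
            · refine (le_sup_left : G ≤ G ⊔ H) ?_
              rw [← (hS' G hG).2]
              exact Or.inr ⟨hy, hxG⟩
            · refine (le_sup_right : H ≤ G ⊔ H) ?_
              rw [← (hS' H hH).2]
              exact Or.inr ⟨hy, hxH⟩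
          rw [oneBlock_le]
          intro u hu v hv
          exact Setoid.trans' _ (key u hu) (Setoid.symm' _ (key v hv))
      rw [this]
      exact oneBlock_mem_minimalBuildingSet
        ((hS' G hG).1.trans_le (Finset.card_le_card Finset.subset_union_left))
  · intro h T hT h2 hanti hmem
    obtain ⟨G, hG, H, hH, hne⟩ := Finset.one_lt_card.1 h2
    have hdisj : ∀ K ∈ T, K ≠ G → Disjoint G.support K.support := by
      intro K hK hKG
      rcases h G (hT hG) K (hT hK) with g | g | g
      · exact absurd ((hle G (hT hG) K (hT hK)).2 g) (hanti hG hK hKG.symm)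
      · exact absurd ((hle K (hT hK) G (hT hG)).2 g) (hanti hK hG hKG)
      · exact g
    -- The two-class partition into `G.support` and its complement bounds the join from above and
    -- separates `G` from `H`.
    let r : Setoid α :=
      { r := fun x y => x ∈ G.support ↔ y ∈ G.support
        iseqv := ⟨fun x => Iff.rfl, fun h => h.symm, fun h h' => h.trans h'⟩ }
    have hr : T.sup id ≤ r := by
      refine Finset.sup_le fun K hK => ?_
      rw [id, ← (hS' K (hT hK)).2, oneBlock_le]
      intro x hx y hy
      change x ∈ G.support ↔ y ∈ G.support
      by_cases hKG : K = G
      · subst hKG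
        exact iff_of_true hx hy
      · have := Finset.disjoint_right.1 (hdisj K hK hKG)
        exact iff_of_false (this hx) (this hy)
    obtain ⟨A, hA, hsup⟩ := exists_oneBlock_of_mem_minimalBuildingSet hmem
    have hsub : ∀ K ∈ T, K.support ⊆ A := by
      intro K hK
      rw [← oneBlock_le_oneBlock (hS' K (hT hK)).1, (hS' K (hT hK)).2, ← hsup]
      exact Finset.le_sup (f := id) hK
    obtain ⟨x, hx⟩ := Finset.card_pos.1 ((Nat.zero_lt_one).trans (hS' G (hT hG)).1)
    obtain ⟨y, hy⟩ := Finset.card_pos.1 ((Nat.zero_lt_one).trans (hS' H (hT hH)).1)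
    have hxy : r x y := hr (hsup ▸ Or.inr ⟨hsub G hG hx, hsub H hH hy⟩)
    exact Finset.disjoint_right.1 (hdisj H hH hne.symm) hy (hxy.1 hx)

theorem maximal_minimalBuildingSet_iff [Fintype α] {G : Setoid α}
    (hG : G ∈ minimalBuildingSet (Setoid α)) :
    Maximal (· ∈ minimalBuildingSet (Setoid α)) G ↔ G.support = Finset.univ := by
  obtain ⟨h1, h2⟩ := mem_minimalBuildingSet_iff.1 hG
  constructor
  · intro h
    have hU : 1 < (Finset.univ : Finset α).card := h1.trans_le (Finset.card_le_univ _)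
    have := h.2 (oneBlock_mem_minimalBuildingSet hU) (by
      rw [← h2, oneBlock_le_oneBlock h1]; exact Finset.subset_univ _)
    rw [← h2, oneBlock_le_oneBlock hU] at this
    exact Finset.univ_subset_iff.1 this
  · intro h
    refine ⟨hG, fun H _ _ => ?_⟩
    obtain ⟨g1, g2⟩ := mem_minimalBuildingSet_iff.1 ‹_›
    rw [← g2, ← h2, oneBlock_le_oneBlock g1, h]
    exact Finset.subset_univ _

end OneBlock

/-! ### The `h`-polynomial in terms of face numbers. -/

namespace FaceComplex

theorem reflect_X_sub_one_pow (k : ℕ) :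
    reflect k ((X - 1 : ℤ[X]) ^ k) = (1 - X) ^ k := by
  induction k with
  | zero => simp
  | succ k ih =>
    have h1 : (X - 1 : ℤ[X]).natDegree ≤ 1 := by
      simpa using natDegree_X_sub_C_le (1 : ℤ)
    have h2 : ((X - 1 : ℤ[X]) ^ k).natDegree ≤ k := by
      simpa using natDegree_pow_le_of_le k h1
    have h3 : reflect 1 (X - 1 : ℤ[X]) = 1 - X := by
      rw [reflect_sub]
      rw [reflect_one, pow_one, reflect_one_X]
    rw [pow_succ, reflect_mul _ _ h2 h1, ih, h3, pow_succ]

/-- Reading the coefficients backwards is `y ^ d * p (1 / y)`, which takes `(y - 1) ^ (d - i)` to `y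
^ i * (1 - y) ^ (d - i)`. -/
theorem hPolynomial_eq_sum {V : Type*} (Δ : FaceComplex V) :
    Δ.hPolynomial = ∑ i ∈ Finset.range (Δ.topCard + 1),
      C (Δ.fNum i : ℤ) * (X ^ i * (1 - X) ^ (Δ.topCard - i)) := by
  set d := Δ.topCard with hd
  have key : ∀ i ∈ Finset.range (d + 1), reflect d (C (Δ.fNum i : ℤ) * (X - 1) ^ (d - i)) =
      C (Δ.fNum i : ℤ) * (X ^ i * (1 - X) ^ (d - i)) := by
    intro i hi
    have hi' : i ≤ d := Nat.lt_succ_iff.1 (Finset.mem_range.1 hi)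
    have h1 : (X - 1 : ℤ[X]).natDegree ≤ 1 := by
      simpa using natDegree_X_sub_C_le (1 : ℤ)
    have h2 : ((X - 1 : ℤ[X]) ^ (d - i)).natDegree ≤ d - i := by
      simpa using natDegree_pow_le_of_le (d - i) h1
    have h3 := reflect_mul (1 : ℤ[X]) ((X - 1) ^ (d - i)) (F := i) (by simp) h2
    rw [Nat.add_sub_cancel' hi', one_mul, reflect_one, reflect_X_sub_one_pow] at h3
    rw [reflect_C_mul, h3]
  have hsum : ∀ (s : Finset ℕ) (f : ℕ → ℤ[X]), reflect d (∑ i ∈ s, f i) = ∑ i ∈ s, reflect d (f i) := by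
    intro s f
    ext j
    simp [coeff_reflect]
  rw [← Finset.sum_congr rfl key, ← hsum]
  ext j
  rw [coeff_reflect, hPolynomial, finsetSum_coeff]
  simp only [coeff_C_mul_X_pow, ← hd]
  rw [Finset.sum_ite_eq]
  split_ifs with h
  · rw [revAt_le (Nat.lt_succ_iff.1 (Finset.mem_range.1 h))]
    rfl
  -- `reflect d` fixes coefficients above `d`; they vanish because every summand has degree at most
  -- `d`.
  · have hj : d < j := by simpa using h
    rw [revAt_eq_self_of_lt hj, finsetSum_coeff]
    symm
    refine Finset.sum_eq_zero fun i _ => ?_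
    refine coeff_eq_zero_of_natDegree_lt (lt_of_le_of_lt ?_ hj)
    refine (natDegree_C_mul_le _ _).trans ?_
    have h1 : (X - 1 : ℤ[X]).natDegree ≤ 1 := by
      simpa using natDegree_X_sub_C_le (1 : ℤ)
    have h2 := natDegree_pow_le_of_le (d - i) h1
    omega

end FaceComplex

/-- The polynomial `∑ᵢ fᵢ xⁱ (1 - x)^(n-1-i)` where `fᵢ` is the number of trees with `n + 1`
leaves and `i + 1` further nodes. -/
noncomputable def wardPolynomial (n : ℕ) : ℤ[X] :=
  ∑ i ∈ Finset.range n, C (wardNumber n (i + 1) : ℤ) * (X ^ i * (1 - X) ^ (n - 1 - i))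

/-- Holds summand by summand: with `k = n - 1 - i`, each side multiplies `x ^ i (1 - x) ^ k` by `i +
1 + (n + 1) x`. The bound `1 ≤ n` is needed since `wardNumber 0 0 = 1`. -/
theorem wardPolynomial_succ {n : ℕ} (hn : 1 ≤ n) :
    wardPolynomial (n + 1) =
      (1 + 2 * (n : ℤ[X]) * X) * wardPolynomial n +
        X * (1 - X) * derivative (wardPolynomial n) := by
  have h0 : wardNumber n 0 = 0 := by
    obtain ⟨n, rfl⟩ := Nat.exists_eq_add_of_le' hn
    rfl
  have hs : wardPolynomial (n + 1) =
      ∑ i ∈ Finset.range (n + 1),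
        C (((i + 1) * wardNumber n (i + 1) : ℕ) : ℤ) * (X ^ i * (1 - X) ^ (n - i)) +
      ∑ i ∈ Finset.range (n + 1),
        C (((n + 1 + i) * wardNumber n i : ℕ) : ℤ) * (X ^ i * (1 - X) ^ (n - i)) := by
    rw [wardPolynomial, ← Finset.sum_add_distrib]
    refine Finset.sum_congr rfl fun i _ => ?_
    rw [wardNumber, ← add_mul, ← C_add, ← Nat.cast_add, Nat.add_sub_cancel]
  -- The dropped boundary terms carry `wardNumber n (n + 1)` and `wardNumber n 0`, both zero; the
  -- second sum is thereby shifted to the index of the first.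
  rw [hs, Finset.sum_range_succ, Finset.sum_range_succ', wardNumber_eq_zero (Nat.lt_succ_self n),
    h0, wardPolynomial, derivative_sum, Finset.mul_sum, Finset.mul_sum, ← Finset.sum_add_distrib]
  simp only [mul_zero, Nat.cast_zero, C_0, zero_mul, add_zero]
  rw [← Finset.sum_add_distrib]
  refine Finset.sum_congr rfl fun i hi => ?_
  obtain ⟨k, rfl⟩ := Nat.exists_eq_add_of_lt (Finset.mem_range.1 hi)
  rw [show i + k + 1 - i = k + 1 by omega, show i + k + 1 - (i + 1) = k by omega,
    show i + k + 1 - 1 - i = k by omega]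
  have hd : X * (1 - X) * derivative ((X : ℤ[X]) ^ i * (1 - X) ^ k) =
      ((i : ℤ[X]) * (1 - X) - (k : ℤ[X]) * X) * (X ^ i * (1 - X) ^ k) := by
    rw [derivative_mul, derivative_X_pow, derivative_pow]
    rcases i with _ | i <;> rcases k with _ | k <;> simp <;> ring
  rw [derivative_C_mul, mul_left_comm (X * (1 - X)), hd]
  push_cast
  simp only [C_mul, C_add, C_1, map_natCast]
  ring

theorem wardPolynomial_eq_secondEulerianPolynomial {n : ℕ} (hn : 1 ≤ n) :
    wardPolynomial n = secondEulerianPolynomial n := by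
  induction n, hn using Nat.le_induction with
  | base =>
    rw [secondEulerianPolynomial_succ, secondEulerianPolynomial_zero]
    simp [wardPolynomial, wardNumber]
  | succ n hn ih => rw [wardPolynomial_succ hn, secondEulerianPolynomial_succ, ih]

/-! ### Faces of the nested set complex as laminar families. -/

section Count

/-- The vertices of the nested set complex of the partition lattice. -/
abbrev NestedVertex (α : Type*) : Type _ :=
  {G : Setoid α // G ∈ minimalBuildingSet (Setoid α) ∧
    ¬ Maximal (· ∈ minimalBuildingSet (Setoid α)) G}

variable {α : Type*} [Fintype α] [DecidableEq α]

namespace NestedVertex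

omit [DecidableEq α] in
theorem one_lt_card_support (G : NestedVertex α) : 1 < G.1.support.card :=
  (mem_minimalBuildingSet_iff.1 G.2.1).1

omit [DecidableEq α] in
theorem oneBlock_support (G : NestedVertex α) : oneBlock G.1.support = G.1 :=
  (mem_minimalBuildingSet_iff.1 G.2.1).2

omit [DecidableEq α] in
theorem support_ne_univ (G : NestedVertex α) : G.1.support ≠ Finset.univ := fun h =>
  G.2.2 ((maximal_minimalBuildingSet_iff G.2.1).2 h)

omit [DecidableEq α] in
theorem support_injective : Function.Injective fun G : NestedVertex α => G.1.support := by
  intro G H h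
  apply Subtype.ext
  rw [← G.oneBlock_support, ← H.oneBlock_support]
  exact congrArg oneBlock h

omit [DecidableEq α] in
theorem exists_support_eq {A : Finset α} (hA : 1 < A.card) (h : A ≠ Finset.univ) :
    ∃ G : NestedVertex α, G.1.support = A := by
  have hs := support_oneBlock hA
  have hm := oneBlock_mem_minimalBuildingSet hA
  exact ⟨⟨oneBlock A, hm, fun hmax => h (hs ▸ (maximal_minimalBuildingSet_iff hm).1 hmax)⟩, hs⟩

instance : Finite (NestedVertex α) := Finite.of_injective _ support_injective

end NestedVertex

/-- The nonsingleton blocks of the members of `F`, together with all singletons and the full set. -/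
noncomputable def blockFamily (F : Finset (NestedVertex α)) : Finset (Finset α) :=
  insert Finset.univ ((F.image fun G => G.1.support) ∪ Finset.univ.image fun x => {x})

theorem mem_blockFamily {F : Finset (NestedVertex α)} {B : Finset α} :
    B ∈ blockFamily F ↔ B = Finset.univ ∨ (∃ G ∈ F, G.1.support = B) ∨ ∃ x, {x} = B := by
  simp [blockFamily]

theorem support_mem_blockFamily {F : Finset (NestedVertex α)} {G : NestedVertex α} :
    G.1.support ∈ blockFamily F ↔ G ∈ F := by
  rw [mem_blockFamily]
  constructor
  · rintro (h | ⟨H, hH, h⟩ | ⟨x, h⟩)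
    · exact absurd h G.support_ne_univ
    · rwa [← NestedVertex.support_injective h]
    · have := G.one_lt_card_support
      rw [← h, Finset.card_singleton] at this
      omega
  · intro h
    exact Or.inr (Or.inl ⟨G, h, rfl⟩)

theorem blockFamily_injective : Function.Injective (blockFamily (α := α)) := by
  intro F F' h
  ext G
  rw [← support_mem_blockFamily, h, support_mem_blockFamily]

omit [DecidableEq α] in
theorem mem_faces_nestedSetComplex {F : Finset (NestedVertex α)} :
    F ∈ (nestedSetComplex (Setoid α) (minimalBuildingSet (Setoid α))).faces ↔
      ∀ G ∈ F, ∀ H ∈ F, G.1.support ⊆ H.1.support ∨ H.1.support ⊆ G.1.support ∨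
        Disjoint G.1.support H.1.support := by
  change IsNestedSet _ _ ↔ _
  rw [isNestedSet_iff]
  constructor
  · rintro ⟨-, h⟩ G hG H hH
    exact h G.1 (Finset.mem_map_of_mem (Function.Embedding.subtype _) hG) H.1
      (Finset.mem_map_of_mem (Function.Embedding.subtype _) hH)
  · intro h
    refine ⟨fun G hG => ?_, fun G hG H hH => ?_⟩
    · obtain ⟨G, hG, rfl⟩ := Finset.mem_map.1 hG
      exact G.2.1
    · obtain ⟨G, hG', rfl⟩ := Finset.mem_map.1 hG
      obtain ⟨H, hH', rfl⟩ := Finset.mem_map.1 hH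
      exact h G hG' H hH'

theorem isFullLaminar_blockFamily [Nonempty α] {F : Finset (NestedVertex α)} :
    IsFullLaminar Finset.univ (blockFamily F) ↔
      F ∈ (nestedSetComplex (Setoid α) (minimalBuildingSet (Setoid α))).faces := by
  rw [mem_faces_nestedSetComplex]
  constructor
  · intro h G hG H hH
    exact h.laminar _ (support_mem_blockFamily.2 hG) _ (support_mem_blockFamily.2 hH)
  · intro h
    refine ⟨fun A hA => ?_, fun A _ => Finset.subset_univ A,
      fun x _ => mem_blockFamily.2 (Or.inr (Or.inr ⟨x, rfl⟩)),
      mem_blockFamily.2 (Or.inl rfl), fun A hA B hB => ?_⟩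
    · rcases mem_blockFamily.1 hA with rfl | ⟨G, hG, rfl⟩ | ⟨x, rfl⟩
      · exact Finset.univ_nonempty
      · exact Finset.card_pos.1 (Nat.zero_lt_one.trans G.one_lt_card_support)
      · exact Finset.singleton_nonempty x
    · have single : ∀ (x : α) (C : Finset α), {x} ⊆ C ∨ Disjoint {x} C := by
        intro x C
        by_cases hx : x ∈ C
        · exact Or.inl (Finset.singleton_subset_iff.2 hx)
        · exact Or.inr (Finset.disjoint_singleton_left.2 hx)
      rcases mem_blockFamily.1 hA with rfl | ⟨G, hG, rfl⟩ | ⟨x, rfl⟩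
      · exact Or.inr (Or.inl (Finset.subset_univ B))
      · rcases mem_blockFamily.1 hB with rfl | ⟨H, hH, rfl⟩ | ⟨x, rfl⟩
        · exact Or.inl (Finset.subset_univ _)
        · exact h G hG H hH
        · rcases single x G.1.support with g | g
          · exact Or.inr (Or.inl g)
          · exact Or.inr (Or.inr g.symm)
      · rcases single x B with g | g
        · exact Or.inl g
        · exact Or.inr (Or.inr g)

theorem card_blockFamily (h2 : 1 < Fintype.card α) {F : Finset (NestedVertex α)}
    (hF : IsFullLaminar Finset.univ (blockFamily F)) :
    (blockFamily F).card = Fintype.card α + (F.card + 1) := by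
  have h : (blockFamily F).filter (fun N => 1 < N.card) =
      insert Finset.univ (F.image fun G => G.1.support) := by
    ext B
    rw [Finset.mem_filter, mem_blockFamily, Finset.mem_insert, Finset.mem_image]
    constructor
    · rintro ⟨h | h | ⟨x, rfl⟩, hB⟩
      · exact Or.inl h
      · exact Or.inr h
      · simp at hB
    · rintro (rfl | ⟨G, hG, rfl⟩)
      · exact ⟨Or.inl rfl, h2⟩
      · exact ⟨Or.inr (Or.inl ⟨G, hG, rfl⟩), G.one_lt_card_support⟩
  rw [← hF.card_filter_one_lt, h, Finset.card_insert_of_notMem,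
    Finset.card_image_of_injective _ NestedVertex.support_injective, Finset.card_univ, add_comm]
  intro hm
  obtain ⟨G, -, h⟩ := Finset.mem_image.1 hm
  exact G.support_ne_univ h

theorem exists_blockFamily_eq {F : Finset (Finset α)} (hF : IsFullLaminar Finset.univ F) :
    ∃ F' : Finset (NestedVertex α), blockFamily F' = F := by
  classical
  have := Fintype.ofFinite (NestedVertex α)
  refine ⟨({G | G.1.support ∈ F} : Finset (NestedVertex α)), ?_⟩
  ext B
  rw [mem_blockFamily]
  constructor
  · rintro (rfl | ⟨G, hG, rfl⟩ | ⟨x, rfl⟩)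
    · exact hF.top_mem
    · exact (Finset.mem_filter.1 hG).2
    · exact hF.singleton_mem x (Finset.mem_univ x)
  · intro hB
    by_cases h1 : 1 < B.card
    · by_cases h : B = Finset.univ
      · exact Or.inl h
      · obtain ⟨G, rfl⟩ := NestedVertex.exists_support_eq h1 h
        exact Or.inr (Or.inl ⟨G, Finset.mem_filter.2 ⟨Finset.mem_univ _, hB⟩, rfl⟩)
    · obtain ⟨x, hx⟩ := Finset.card_eq_one.1
        (le_antisymm (not_lt.1 h1) (hF.nonempty B hB).card_pos)
      exact Or.inr (Or.inr ⟨x, hx.symm⟩)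

/-- The shift `i + 1` accounts for the root, which is an internal node of the tree but not a vertex
of the complex. -/
theorem fNum_nestedSetComplex {n : ℕ} (hn : 1 ≤ n) (hα : Fintype.card α = n + 1) (i : ℕ) :
    (nestedSetComplex (Setoid α) (minimalBuildingSet (Setoid α))).fNum i =
      wardNumber n (i + 1) := by
  have : Nonempty α := Fintype.card_pos_iff.1 (by omega)
  rw [← card_fullLaminar n (Finset.univ : Finset α) (by rw [Finset.card_univ, hα]) (i + 1),
    ← Set.ncard_coe_finset, FaceComplex.fNum]
  refine Set.ncard_congr (fun F _ => blockFamily F) ?_ ?_ ?_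
  · rintro F ⟨hF, rfl⟩
    have h := isFullLaminar_blockFamily.2 hF
    rw [Finset.mem_coe, mem_fullLaminar, card_blockFamily (by omega) h, hα]
    exact ⟨h, rfl⟩
  · intro F F' _ _ h
    exact blockFamily_injective h
  · intro F hF
    rw [Finset.mem_coe, mem_fullLaminar] at hF
    obtain ⟨F, rfl⟩ := exists_blockFamily_eq hF.1
    have hc := hF.2
    rw [card_blockFamily (by omega) hF.1, hα] at hc
    exact ⟨F, ⟨isFullLaminar_blockFamily.1 hF.1, by omega⟩, rfl⟩

theorem topCard_nestedSetComplex {n : ℕ} (hn : 1 ≤ n) (hα : Fintype.card α = n + 1) :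
    (nestedSetComplex (Setoid α) (minimalBuildingSet (Setoid α))).topCard = n - 1 := by
  refine IsGreatest.csSup_eq ⟨?_, ?_⟩
  · have h := fNum_nestedSetComplex hn hα (n - 1)
    rw [Nat.sub_add_cancel hn] at h
    have hpos := wardNumber_self_pos n
    rw [← h] at hpos
    obtain ⟨F, hF, hc⟩ := Set.nonempty_of_ncard_ne_zero hpos.ne'
    exact ⟨F, hF, hc⟩
  · rintro _ ⟨F, hF, rfl⟩
    by_contra hc
    have h := fNum_nestedSetComplex hn hα F.card
    -- Finiteness matters here, since `ncard` is also zero on infinite sets.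
    rw [wardNumber_eq_zero (by omega), FaceComplex.fNum, Set.ncard_eq_zero (Set.toFinite _)] at h
    exact (Set.eq_empty_iff_forall_notMem.1 h) F ⟨hF, rfl⟩

end Count

theorem mainTheorem6 (n : ℕ) (hn : 1 ≤ n) :
    (nestedSetComplex (PartitionLattice (n + 1))
      (minimalBuildingSet (PartitionLattice (n + 1)))).hPolynomial =
    secondEulerianPolynomial n := by
  rw [FaceComplex.hPolynomial_eq_sum, topCard_nestedSetComplex hn (Fintype.card_fin _),
    ← wardPolynomial_eq_secondEulerianPolynomial hn, wardPolynomial, Nat.sub_add_cancel hn]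
  refine Finset.sum_congr rfl fun i _ => ?_
  rw [fNum_nestedSetComplex hn (Fintype.card_fin _)]
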